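/- Let $d\ge 1$, let $\|\cdot\|$ denote the Euclidean norm on $\mathbb{R}^d$ and the norm $\|M\|=\bigl(\sum_{i,j}|M_{i,j}|^2\bigr)^{1/2}$ on the space $\mathcal{M}_d(\mathbb{R})$ of real $d\times d$ matrices. Let $F:\mathbb{R}^d\to\mathbb{R}$ be of class $\mathcal{C}^3$ and such that: (i) $\nabla F$ is globally Lipschitz continuous; (ii) for some $\mu\in(0,\infty)$ one has $\langle\nabla F(x_2)-\nabla F(x_1),x_2-x_1\rangle\ge\mu\|x_2-x_1\|^2$ for all $x_1,x_2\in\mathbb{R}^d$; (iii) the third order derivative of $F$ is bounded. Then $F$ has a unique minimizer, denoted by $x^\star$. Let $\sigma:[0,\infty)\times\mathbb{R}^d\to\mathcal{M}_d(\mathbb{R})$ be continuous, and assume that there is a bounded function $\varsigma:[0,\infty)\to[0,\infty)$ such that for all $t\ge 0$ one has \[ \|\sigma(t,x_2)-\sigma(t,x_1)\|\le\varsigma(t)\|x_2-x_1\|\quad\forall x_1,x_2\in\mathbb{R}^d,\qquad \sup_{x\in\mathbb{R}^d}\frac{\|\sigma(t,x)\|}{1+\|x-x^\star\|}\le\varsigma(t).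 \] Let $(\gamma_n)_{n\ge 1}$ be independent standard centered Gaussian random variables with values in $\mathbb{R}^d$. For $h>0$ and a deterministic $x_0\in\mathbb{R}^d$ define \[ X_0=x_0,\qquad X_{n+1}=X_n-h\nabla F(X_n)+h\,\sigma(nh,X_n)\gamma_{n+1},\quad n\ge 0. \] For $\varphi:\mathbb{R}^d\to\mathbb{R}$ of class $\mathcal{C}^2$ set \[ |\!|\!|\varphi|\!|\!|_2=\sup_{x\in\mathbb{R}^d}\ \sup_{k_1,k_2\in\mathbb{R}^d\setminus\{0\}}\frac{|D^2\varphi(x).(k_1,k_2)|}{\|k_1\|\|k_2\|}. \] Let $h_{\max}>0$. There exist $H\in(0,h_{\max})$ and $C\in(0,\infty)$ such that for any $\varphi:\mathbb{R}^d\to\mathbb{R}$ of class $\mathcal{C}^2$ with bounded second order derivative, any $x_0\in\mathbb{R}^d$, any integer $N\ge 1$ and any $h\in(0,H)$, the random variable $\varphi(X_N)$ is integrable and \[ \bigl|\mathbb{E}[\varphi(X_N)]-\varphi(x^\star)\bigr|\le C\bigl(\|\nabla\varphi(x^\star)\|+|\!|\!|\varphi|\!|\!|_2\bigr)\bigl(1+\|x_0-x^\star\|^3\bigr)\bigl(e^{-\mu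 Nh}+h\bigr). \] -/

import Mathlib

open MeasureTheory ProbabilityTheory Set
open scoped Gradient

namespace SGD

/-- The Euclidean space `ℝ^d` with its standard inner product and norm. -/
abbrev E (d : ℕ) : Type := EuclideanSpace ℝ (Fin d)

/-- The norm `(∑ i j, |M i j|^2)^(1/2)` on square matrices. -/
noncomputable def matNorm {d : ℕ} (M : Matrix (Fin d) (Fin d) ℝ) : ℝ :=
  √(∑ i, ∑ j, |M i j| ^ 2)

/-- The product of a matrix with a vector of the Euclidean space. -/
noncomputable def matVec {d : ℕ} (M : Matrix (Fin d) (Fin d) ℝ) (v : E d) : E d :=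
  WithLp.toLp 2 (M.mulVec (WithLp.ofLp v))

/-- The objective function is of class `C^3`, has a globally Lipschitz gradient, is `μ`-convex with
`μ > 0`, and has a bounded third order derivative. -/
structure ObjectiveAssumption {d : ℕ} (F : E d → ℝ) (μ : ℝ) : Prop where
  contDiff : ContDiff ℝ 3 F
  lipschitz : ∃ L : ℝ, 0 < L ∧ ∀ x₁ x₂ : E d, ‖∇ F x₂ - ∇ F x₁‖ ≤ L * ‖x₂ - x₁‖
  mu_pos : 0 < μ
  mu_convex : ∀ x₁ x₂ : E d, inner ℝ (∇ F x₂ - ∇ F x₁) (x₂ - x₁) ≥ μ * ‖x₂ - x₁‖ ^ 2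
  bounded_third : ∃ M : ℝ, ∀ x : E d, ‖iteratedFDeriv ℝ 3 F x‖ ≤ M

/-- The diffusion coefficient is continuous on `[0,∞) × ℝ^d`; for every time `t ≥ 0` it is globally
Lipschitz and of at most linear growth around `xs`, with a constant `ς t`, and `ς` is bounded.
Only the values at times `t ≥ 0` matter. -/
structure DiffusionAssumption {d : ℕ} (σ : ℝ → E d → Matrix (Fin d) (Fin d) ℝ) (xs : E d) :
    Prop where
  continuousOn : ContinuousOn (fun p : ℝ × E d => σ p.1 p.2) (Ici (0 : ℝ) ×ˢ univ)
  exists_bound : ∃ ς : ℝ → ℝ,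
    (∀ t, 0 ≤ t → 0 ≤ ς t) ∧
    (∀ t, 0 ≤ t → ∀ x₁ x₂ : E d, matNorm (σ t x₂ - σ t x₁) ≤ ς t * ‖x₂ - x₁‖) ∧
    (∀ t, 0 ≤ t → ∀ x : E d, matNorm (σ t x) / (1 + ‖x - xs‖) ≤ ς t) ∧
    (∃ K : ℝ, ∀ t, 0 ≤ t → ς t ≤ K)

/-- The scheme `X (n+1) = X n - h ∇F(X n) + h σ(t n, X n) γ (n+1)`, `X 0 = x₀`, with `t n = n h`. -/
noncomputable def scheme {d : ℕ} {Ω : Type*} (F : E d → ℝ)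
    (σ : ℝ → E d → Matrix (Fin d) (Fin d) ℝ) (γ : ℕ → Ω → E d) (h : ℝ) (x₀ : E d) :
    ℕ → Ω → E d
  | 0, _ => x₀
  | n + 1, ω =>
    scheme F σ γ h x₀ n ω - h • ∇ F (scheme F σ γ h x₀ n ω)
      + h • matVec (σ (n * h) (scheme F σ γ h x₀ n ω)) (γ (n + 1) ω)

/-- The supremum over `x` of the operator norm of the differential of order `m` of `φ` at `x`,
that is, of the least `c` such that `|D^m φ(x).(k₁,…,k_m)| ≤ c ‖k₁‖ ⋯ ‖k_m‖` for all directions.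
It is meaningful when these norms are bounded in `x`. -/
noncomputable def tripleNorm {d : ℕ} (m : ℕ) (φ : E d → ℝ) : ℝ :=
  ⨆ x : E d, ‖iteratedFDeriv ℝ m φ x‖

end SGD

/-!
At the minimizer `xs` the gradient vanishes, and strong monotonicity makes the Euler step
`x ↦ x - h ∇F(x)` contract towards `xs`. The noise enters with a factor `h` and is uncorrelated
with the deterministic part of the step, so it adds only `O(h ^ 2)` to the second moment
`a n = E ‖X n - xs‖ ^ 2`, which therefore contracts by `1 - 3 μ h / 2` at each step until it is
`O(h)`.

Bounding first moments by `√(a n)` would only give `O(√h)` and the rate `exp (-3 μ N h / 4)`. But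
the mean does not see the noise: up to a Taylor remainder of size `h a n`, the vector `E X n - xs`
is multiplied by `1 - h D²F(xs)`, whose norm is at most `1 - μ h` because the Hessian is symmetric.
Since `a n` contracts faster than that, `‖E X n - xs‖ + c a n` contracts by `1 - μ h` for a suitable
constant `c`. Expanding `φ` to second order at `xs` then gives the result.
-/

open scoped NNReal RealInnerProductSpace

namespace SGD

section Taylor

variable {V G : Type*} [NormedAddCommGroup V] [NormedSpace ℝ V]
  [NormedAddCommGroup G] [NormedSpace ℝ G] {f : V → G} {K : ℝ≥0}

lemma norm_sub_sub_fderiv_le (hf : Differentiable ℝ f) (hK : LipschitzWith K (fderiv ℝ f))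
    (x y : V) : ‖f y - f x - fderiv ℝ f x (y - x)‖ ≤ K * ‖y - x‖ ^ 2 := by
  have hball : ∀ w ∈ Metric.closedBall x ‖y - x‖,
      ‖fderiv ℝ f w - fderiv ℝ f x‖ ≤ K * ‖y - x‖ := fun w hw =>
    (hK.norm_sub_le w x).trans (by gcongr; rwa [← mem_closedBall_iff_norm])
  have h := Convex.norm_image_sub_le_of_norm_fderiv_le' (fun w _ => hf w) hball
    (convex_closedBall x ‖y - x‖) (Metric.mem_closedBall_self (norm_nonneg _))
    (mem_closedBall_iff_norm.2 le_rfl)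
  rwa [mul_assoc, ← sq] at h

lemma lipschitzWith_fderiv_of_norm_iteratedFDeriv_two_le (hf : ContDiff ℝ 2 f)
    (hK : ∀ x, ‖iteratedFDeriv ℝ 2 f x‖ ≤ K) : LipschitzWith K (fderiv ℝ f) := by
  refine lipschitzWith_of_nnnorm_fderiv_le
    ((hf.fderiv_right (m := 1) (by norm_num)).differentiable (by norm_num)) fun x => ?_
  rw [← NNReal.coe_le_coe, coe_nnnorm, ← norm_iteratedFDeriv_one, norm_iteratedFDeriv_fderiv]
  exact hK x

end Taylor

section Monotone

variable {V : Type*} [NormedAddCommGroup V] [InnerProductSpace ℝ V]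

/-- Strong monotonicity of a vector field with constant `μ`: for `b = ∇ F` this is the
`μ`-convexity of `F`, and for Lipschitz `b` it makes the steps `x ↦ x - h b x` contract for small
`h > 0`. -/
def StronglyMonotone (μ : ℝ) (b : V → V) : Prop :=
  ∀ x y, μ * ‖y - x‖ ^ 2 ≤ ⟪b y - b x, y - x⟫

namespace StronglyMonotone

variable {b : V → V} {μ h : ℝ} {L : ℝ≥0}

lemma norm_step_sub_step_sq_le (hb : StronglyMonotone μ b) (hL : LipschitzWith L b) (hh : 0 ≤ h)
    (x y : V) :
    ‖(y - h • b y) - (x - h • b x)‖ ^ 2 ≤ (1 - 2 * μ * h + L ^ 2 * h ^ 2) * ‖y - x‖ ^ 2 := by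
  have hlip : ‖b y - b x‖ ^ 2 ≤ L ^ 2 * ‖y - x‖ ^ 2 := by
    rw [← mul_pow]
    gcongr
    exact hL.norm_sub_le y x
  calc ‖(y - h • b y) - (x - h • b x)‖ ^ 2
      = ‖(y - x) - h • (b y - b x)‖ ^ 2 := by rw [smul_sub, sub_sub_sub_comm]
    _ = ‖y - x‖ ^ 2 - 2 * h * ⟪b y - b x, y - x⟫ + h ^ 2 * ‖b y - b x‖ ^ 2 := by
        rw [norm_sub_sq_real, real_inner_smul_right, norm_smul, mul_pow, Real.norm_eq_abs, sq_abs,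
          real_inner_comm]
        ring
    _ ≤ ‖y - x‖ ^ 2 - 2 * h * (μ * ‖y - x‖ ^ 2) + h ^ 2 * (L ^ 2 * ‖y - x‖ ^ 2) := by
        gcongr
        exact hb x y
    _ = _ := by ring

lemma eq_of_eq_zero (hb : StronglyMonotone μ b) (hμ : 0 < μ) {x y : V} (hx : b x = 0)
    (hy : b y = 0) : x = y := by
  have h := hb y x
  rw [hx, hy, sub_zero, inner_zero_left] at h
  have hsq : ‖x - y‖ ^ 2 = 0 := le_antisymm (nonpos_of_mul_nonpos_right h hμ) (sq_nonneg _)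
  simpa [sub_eq_zero] using hsq

/-- Zeros of `b` are fixed points of the Euler step, a contraction for the step size chosen. -/
lemma exists_eq_zero [CompleteSpace V] (hb : StronglyMonotone μ b) (hμ : 0 < μ)
    (hL : LipschitzWith L b) : ∃ x, b x = 0 := by
  set h : ℝ := μ / (L ^ 2 + μ ^ 2) with hh
  set q : ℝ := L ^ 2 / (L ^ 2 + μ ^ 2) with hq
  have hh0 : 0 < h := by positivity
  have hq0 : 0 ≤ q := by positivity
  have hq1 : q < 1 := (div_lt_one (by positivity)).2 (lt_add_of_pos_right _ (by positivity))
  have hrate : 1 - 2 * μ * h + L ^ 2 * h ^ 2 ≤ q := by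
    have : q - (1 - 2 * μ * h + L ^ 2 * h ^ 2) = (μ ^ 2 / (L ^ 2 + μ ^ 2)) ^ 2 := by
      rw [hq, hh]
      field_simp
      ring
    linarith [sq_nonneg (μ ^ 2 / (L ^ 2 + μ ^ 2))]
  have hcontr : ContractingWith (Real.toNNReal √q) fun x => x - h • b x := by
    refine ⟨by rwa [Real.toNNReal_lt_one, Real.sqrt_lt' one_pos, one_pow],
      .of_dist_le_mul fun y x => ?_⟩
    rw [dist_eq_norm, dist_eq_norm, Real.coe_toNNReal _ (Real.sqrt_nonneg q)]
    refine le_of_sq_le_sq ?_ (by positivity)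
    rw [mul_pow, Real.sq_sqrt hq0]
    exact (hb.norm_step_sub_step_sq_le hL hh0.le x y).trans (by gcongr)
  have hfix : hcontr.fixedPoint - h • b hcontr.fixedPoint = hcontr.fixedPoint :=
    hcontr.fixedPoint_isFixedPt
  exact ⟨_, (smul_eq_zero_iff_right hh0.ne').1 (sub_eq_self.1 hfix)⟩

lemma le_inner_fderiv (hb : StronglyMonotone μ b) {x : V} (hd : DifferentiableAt ℝ b x) (v : V) :
    μ * ‖v‖ ^ 2 ≤ ⟪fderiv ℝ b x v, v⟫ := by
  have hlim := ((hd.hasFDerivAt.hasLineDerivAt v).tendsto_slope_zero_right).inner (𝕜 := ℝ)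
    (tendsto_const_nhds (x := v))
  refine ge_of_tendsto hlim ?_
  filter_upwards [self_mem_nhdsWithin] with t (ht : 0 < t)
  have hmono := hb x (x + t • v)
  rw [add_sub_cancel_left, real_inner_smul_right, norm_smul, mul_pow, Real.norm_eq_abs,
    sq_abs] at hmono
  rw [real_inner_smul_left, inv_mul_eq_div, le_div_iff₀ ht]
  exact le_of_mul_le_mul_left (by linarith) ht

end StronglyMonotone

/-- For a symmetric `A`, `‖1 - h A‖` is the supremum of the Rayleigh quotients, hence the rate
`1 - μ h` instead of the rate `√(1 - 2 μ h + ‖A‖ ^ 2 h ^ 2)` available without symmetry. -/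
lemma norm_sub_smul_apply_le {A : V →L[ℝ] V} (hA : A.IsSymmetric)
    {μ L h : ℝ} (hμ : ∀ v, μ * ‖v‖ ^ 2 ≤ ⟪A v, v⟫) (hL : ‖A‖ ≤ L) (hh : 0 ≤ h)
    (hhL : h * (L + μ) ≤ 2) (hhμ : h * μ ≤ 1) (v : V) :
    ‖v - h • A v‖ ≤ (1 - μ * h) * ‖v‖ := by
  set T : V →L[ℝ] V := ContinuousLinearMap.id ℝ V - h • A with hT
  have hTv : ∀ u, T u = u - h • A u := fun u => by simp [hT]
  have hsymm : T.IsSymmetric := fun u w => by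
    simp only [ContinuousLinearMap.coe_coe, hTv, inner_sub_left, inner_sub_right,
      real_inner_smul_left, real_inner_smul_right]
    congr 2
    exact hA u w
  have hrayleigh : ∀ x, |T.reApplyInnerSelf x| ≤ (1 - μ * h) * ‖x‖ ^ 2 := fun x => by
    have hTx : T.reApplyInnerSelf x = ‖x‖ ^ 2 - h * ⟪A x, x⟫ := by
      simp [ContinuousLinearMap.reApplyInnerSelf, hTv, inner_sub_left, real_inner_smul_left]
    have hle : ⟪A x, x⟫ ≤ L * ‖x‖ ^ 2 := calc
      ⟪A x, x⟫ ≤ ‖A x‖ * ‖x‖ := real_inner_le_norm _ _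
      _ ≤ L * ‖x‖ * ‖x‖ := by gcongr; exact A.le_of_opNorm_le hL x
      _ = L * ‖x‖ ^ 2 := by ring
    have hlow := mul_le_mul_of_nonneg_left (hμ x) hh
    have hupp := mul_le_mul_of_nonneg_left hle hh
    have hstep := mul_le_mul_of_nonneg_right hhL (sq_nonneg ‖x‖)
    rw [hTx, abs_le]
    constructor <;> linarith
  have hnorm : ‖T‖ ≤ 1 - μ * h := by
    rw [ContinuousLinearMap.norm_eq_iSup_rayleighQuotient T hsymm]
    refine ciSup_le fun x => ?_
    rw [ContinuousLinearMap.rayleighQuotient, abs_div, abs_of_nonneg (sq_nonneg ‖x‖)]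
    exact div_le_of_le_mul₀ (sq_nonneg _) (by linarith) (hrayleigh x)
  simpa only [hTv] using T.le_of_opNorm_le hnorm v

end Monotone

section Gradient

variable {V : Type*} [NormedAddCommGroup V] [InnerProductSpace ℝ V] [CompleteSpace V]
  {F : V → ℝ} {μ : ℝ}

lemma gradient_eq_zero_of_forall_le {xs : V} (hxs : ∀ y, F xs ≤ F y) : ∇ F xs = 0 := by
  have hmin : IsLocalMin F xs := .of_forall hxs
  rw [gradient, hmin.fderiv_eq_zero, map_zero]

lemma StronglyMonotone.forall_le_of_gradient_eq_zero (hF : Differentiable ℝ F)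
    (hmono : StronglyMonotone μ (∇ F)) (hμ : 0 ≤ μ) {xs : V} (hxs : ∇ F xs = 0) (y : V) :
    F xs ≤ F y := by
  obtain ⟨z, hz, hFz⟩ := domain_mvt (fun x _ => (hF x).hasFDerivAt.hasFDerivWithinAt)
    convex_univ (mem_univ xs) (mem_univ y)
  rw [segment_eq_image'] at hz
  obtain ⟨t, ht, rfl⟩ := hz
  rw [← sub_nonneg, hFz, ← inner_gradient_left]
  rcases ht.1.eq_or_lt with rfl | ht0
  · simp [hxs]
  · have h := hmono xs (xs + t • (y - xs))
    rw [hxs, sub_zero, add_sub_cancel_left, real_inner_smul_right] at h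
    exact nonneg_of_mul_nonneg_right (h.trans' (by positivity)) ht0

lemma StronglyMonotone.existsUnique_forall_le {L : ℝ≥0} (hF : Differentiable ℝ F)
    (hmono : StronglyMonotone μ (∇ F)) (hμ : 0 < μ) (hL : LipschitzWith L (∇ F)) :
    ∃! xs, ∀ y, F xs ≤ F y := by
  obtain ⟨xs, hxs⟩ := hmono.exists_eq_zero hμ hL
  exact ⟨xs, hmono.forall_le_of_gradient_eq_zero hF hμ.le hxs, fun y hy =>
    hmono.eq_of_eq_zero hμ (gradient_eq_zero_of_forall_le hy) hxs⟩

lemma contDiff_gradient {n m : WithTop ℕ∞} (hF : ContDiff ℝ n F) (hmn : m + 1 ≤ n) :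
    ContDiff ℝ m (∇ F) :=
  (InnerProductSpace.toDual ℝ V).symm.contDiff.comp (hF.fderiv_right hmn)

lemma norm_iteratedFDeriv_gradient (n : ℕ) (x : V) :
    ‖iteratedFDeriv ℝ n (∇ F) x‖ = ‖iteratedFDeriv ℝ (n + 1) F x‖ :=
  ((InnerProductSpace.toDual ℝ V).symm.norm_iteratedFDeriv_comp_left (fderiv ℝ F) x n).trans
    norm_iteratedFDeriv_fderiv

lemma isSymmetric_fderiv_gradient (hF : ContDiff ℝ 2 F) (x : V) :
    (fderiv ℝ (∇ F) x).IsSymmetric := by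
  have hgrad := (contDiff_gradient hF (m := 1) (by norm_num)).differentiable (by norm_num) x
  have hdiff := (hF.fderiv_right (m := 1) (by norm_num)).differentiable (by norm_num) x
  have hhess : ∀ u v, ⟪fderiv ℝ (∇ F) x u, v⟫ = fderiv ℝ (fderiv ℝ F) x u v := fun u v => calc
    ⟪fderiv ℝ (∇ F) x u, v⟫ = fderiv ℝ (fun y => ⟪∇ F y, v⟫) x u := by
      rw [fderiv_inner_apply ℝ hgrad (differentiableAt_const v), fderiv_fun_const, Pi.zero_apply,
        zero_apply, inner_zero_right, zero_add]
    _ = fderiv ℝ (fun y => fderiv ℝ F y v) x u := by simp only [inner_gradient_left]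
    _ = fderiv ℝ (fderiv ℝ F) x u v := by
      simp [fderiv_clm_apply hdiff (differentiableAt_const v)]
  intro u v
  have hsymm := hF.contDiffAt.isSymmSndFDerivAt (x := x) (by simp) u v
  simp only [ContinuousLinearMap.coe_coe]
  rw [real_inner_comm _ u, hhess, hhess, hsymm]

end Gradient

section SquareIntegrable

variable {Ω : Type*} [MeasurableSpace Ω] {P : Measure Ω}

lemma integrable_norm_sub_sq {V : Type*} [NormedAddCommGroup V] [IsFiniteMeasure P] {X : Ω → V}
    (hX : MemLp X 2 P) (xs : V) : Integrable (fun ω => ‖X ω - xs‖ ^ 2) P :=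
  (hX.sub (memLp_const xs)).integrable_norm_pow two_ne_zero

lemma memLp_comp_of_lipschitzWith {V W : Type*} [NormedAddCommGroup V] [NormedAddCommGroup W]
    [IsFiniteMeasure P] {b : V → W} {L : ℝ≥0} {X : Ω → V} (hL : LipschitzWith L b)
    (hX : MemLp X 2 P) : MemLp (fun ω => b (X ω)) 2 P := by
  have hshift : LipschitzWith L fun x => b x - b 0 := by
    simpa using hL.sub (LipschitzWith.const (b 0))
  exact ((hshift.comp_memLp (sub_self _) hX).add (memLp_const (b 0))).ae_eq
    (.of_forall fun ω => sub_add_cancel _ _)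

variable {V : Type*} [NormedAddCommGroup V] [InnerProductSpace ℝ V] {f g : Ω → V}

lemma integrable_inner_of_memLp_two (hf : MemLp f 2 P) (hg : MemLp g 2 P) :
    Integrable (fun ω => ⟪f ω, g ω⟫) P :=
  (hf.norm.integrable_mul hg.norm).mono'
    (hf.aestronglyMeasurable.inner hg.aestronglyMeasurable)
    (.of_forall fun _ => norm_inner_le_norm _ _)

lemma integral_norm_add_sq_of_integral_inner_eq_zero (hf : MemLp f 2 P) (hg : MemLp g 2 P)
    (hfg : ∫ ω, ⟪f ω, g ω⟫ ∂P = 0) :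
    ∫ ω, ‖f ω + g ω‖ ^ 2 ∂P = (∫ ω, ‖f ω‖ ^ 2 ∂P) + ∫ ω, ‖g ω‖ ^ 2 ∂P := by
  have hf2 := hf.integrable_norm_pow two_ne_zero
  have hg2 := hg.integrable_norm_pow two_ne_zero
  have hinner := (integrable_inner_of_memLp_two hf hg).const_mul 2
  have hsum : Integrable (fun ω => ‖f ω‖ ^ 2 + 2 * ⟪f ω, g ω⟫) P := hf2.add hinner
  simp_rw [norm_add_sq_real]
  rw [integral_add hsum hg2, integral_add hf2 hinner, integral_const_mul, hfg, mul_zero, add_zero]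

end SquareIntegrable

section Step

variable {Ω V : Type*} [MeasurableSpace Ω] {P : Measure Ω} [NormedAddCommGroup V]
  [InnerProductSpace ℝ V] {b : V → V} {xs : V} {L : ℝ≥0} {X ξ : Ω → V} {h : ℝ}

lemma memLp_sub_smul_comp [IsFiniteMeasure P] (hL : LipschitzWith L b) (hX : MemLp X 2 P) (h : ℝ) :
    MemLp (fun ω => X ω - h • b (X ω)) 2 P :=
  hX.sub ((memLp_comp_of_lipschitzWith hL hX).const_smul h)

lemma integral_norm_step_sub_sq_le [IsFiniteMeasure P] {μ D : ℝ} (hL : LipschitzWith L b)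
    (hb : StronglyMonotone μ b) (hxs : b xs = 0) (hh : 0 ≤ h) (hX : MemLp X 2 P) (hξ : MemLp ξ 2 P)
    (hcross : ∫ ω, ⟪X ω - h • b (X ω) - xs, ξ ω⟫ ∂P = 0)
    (hξD : ∫ ω, ‖ξ ω‖ ^ 2 ∂P ≤ D * (1 + ∫ ω, ‖X ω - xs‖ ^ 2 ∂P)) :
    ∫ ω, ‖X ω - h • b (X ω) + h • ξ ω - xs‖ ^ 2 ∂P
      ≤ (1 - 2 * μ * h + (L ^ 2 + D) * h ^ 2) * ∫ ω, ‖X ω - xs‖ ^ 2 ∂P + D * h ^ 2 := by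
  have hdrift : MemLp (fun ω => X ω - h • b (X ω) - xs) 2 P :=
    (memLp_sub_smul_comp hL hX h).sub (memLp_const xs)
  have hcontract : ∫ ω, ‖X ω - h • b (X ω) - xs‖ ^ 2 ∂P
      ≤ (1 - 2 * μ * h + L ^ 2 * h ^ 2) * ∫ ω, ‖X ω - xs‖ ^ 2 ∂P := by
    rw [← integral_const_mul]
    refine integral_mono (hdrift.integrable_norm_pow two_ne_zero)
      ((integrable_norm_sub_sq hX xs).const_mul _) fun ω => ?_
    simpa [hxs] using hb.norm_step_sub_step_sq_le hL hh xs (X ω)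
  calc ∫ ω, ‖X ω - h • b (X ω) + h • ξ ω - xs‖ ^ 2 ∂P
      = ∫ ω, ‖(X ω - h • b (X ω) - xs) + h • ξ ω‖ ^ 2 ∂P := by simp_rw [add_sub_right_comm]
    _ = ∫ ω, ‖X ω - h • b (X ω) - xs‖ ^ 2 ∂P + h ^ 2 * ∫ ω, ‖ξ ω‖ ^ 2 ∂P := by
        have horth : ∫ ω, ⟪X ω - h • b (X ω) - xs, h • ξ ω⟫ ∂P = 0 := by
          simp_rw [real_inner_smul_right]
          rw [integral_const_mul, hcross, mul_zero]
        refine (integral_norm_add_sq_of_integral_inner_eq_zero hdrift (hξ.const_smul h)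
          horth).trans ?_
        simp_rw [Pi.smul_apply, norm_smul, mul_pow, Real.norm_eq_abs, sq_abs]
        rw [integral_const_mul]
    _ ≤ (1 - 2 * μ * h + L ^ 2 * h ^ 2) * ∫ ω, ‖X ω - xs‖ ^ 2 ∂P
          + h ^ 2 * (D * (1 + ∫ ω, ‖X ω - xs‖ ^ 2 ∂P)) := by gcongr
    _ = _ := by ring

lemma norm_integral_step_sub_le [IsProbabilityMeasure P] [CompleteSpace V] {A : V →L[ℝ] V}
    {M q : ℝ} (hL : LipschitzWith L b) (hbA : ∀ x, ‖b x - A (x - xs)‖ ≤ M * ‖x - xs‖ ^ 2)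
    (hA : ∀ v, ‖v - h • A v‖ ≤ q * ‖v‖) (hh : 0 ≤ h) (hX : MemLp X 2 P) (hξ : Integrable ξ P)
    (hmean : ∫ ω, ξ ω ∂P = 0) :
    ‖(∫ ω, X ω - h • b (X ω) + h • ξ ω ∂P) - xs‖
      ≤ q * ‖(∫ ω, X ω ∂P) - xs‖ + h * M * ∫ ω, ‖X ω - xs‖ ^ 2 ∂P := by
  have hX1 : Integrable X P := hX.integrable one_le_two
  have hb1 : Integrable (fun ω => b (X ω)) P :=
    (memLp_comp_of_lipschitzWith hL hX).integrable one_le_two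
  have hc1 : Integrable (fun ω => X ω - xs) P := hX1.sub (integrable_const xs)
  have hstep : (∫ ω, X ω - h • b (X ω) + h • ξ ω ∂P)
      = (∫ ω, X ω ∂P) - h • ∫ ω, b (X ω) ∂P := by
    refine (integral_add (hX1.sub (hb1.smul h)) (hξ.smul h)).trans ?_
    rw [integral_sub' hX1 (hb1.smul h)]
    simp only [Pi.smul_apply, integral_smul, hmean, smul_zero, add_zero]
  have hcenter : ∫ ω, X ω - xs ∂P = (∫ ω, X ω ∂P) - xs := by
    rw [integral_sub hX1 (integrable_const xs), integral_const, probReal_univ, one_smul]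
  have hremainder : ‖(∫ ω, b (X ω) ∂P) - A ((∫ ω, X ω ∂P) - xs)‖
      ≤ M * ∫ ω, ‖X ω - xs‖ ^ 2 ∂P := by
    rw [← hcenter, ← A.integral_comp_comm hc1, ← integral_sub hb1 (A.integrable_comp hc1),
      ← integral_const_mul]
    exact norm_integral_le_of_norm_le
      ((integrable_norm_sub_sq hX xs).const_mul M)
      (.of_forall fun ω => hbA (X ω))
  set m := (∫ ω, X ω ∂P) - xs with hm
  calc ‖(∫ ω, X ω - h • b (X ω) + h • ξ ω ∂P) - xs‖
      = ‖(m - h • A m) - h • ((∫ ω, b (X ω) ∂P) - A m)‖ := by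
        rw [hstep, smul_sub, sub_sub_sub_cancel_right, hm]
        congr 1
        abel
    _ ≤ ‖m - h • A m‖ + h * ‖(∫ ω, b (X ω) ∂P) - A m‖ := by
        refine (norm_sub_le _ _).trans_eq ?_
        rw [norm_smul, Real.norm_of_nonneg hh]
    _ ≤ q * ‖m‖ + h * (M * ∫ ω, ‖X ω - xs‖ ^ 2 ∂P) := by gcongr; exact hA m
    _ = _ := by ring

end Step

section Recursion

/-- The combination `m + c a` decays at the rate of `m`, because that of `a` is faster by `μ h / 2`,
enough to absorb the coupling `h M a` as soon as `2 M ≤ c μ`. -/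
lemma add_mul_le_of_recursion {a m : ℕ → ℝ} {μ h M D c : ℝ} (hμ : 0 < μ) (hh : 0 ≤ h)
    (hμh : μ * h ≤ 1) (hD : 0 ≤ D) (hc : 0 ≤ c) (hcM : 2 * M ≤ c * μ) (ha0 : ∀ n, 0 ≤ a n)
    (ha : ∀ n, a (n + 1) ≤ (1 - 3 / 2 * μ * h) * a n + D * h ^ 2)
    (hm : ∀ n, m (n + 1) ≤ (1 - μ * h) * m n + h * M * a n) (h0 : 0 ≤ m 0) (N : ℕ) :
    m N + c * a N ≤ Real.exp (-μ * N * h) * (m 0 + c * a 0) + c * D / μ * h := by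
  have hstep : ∀ n, m (n + 1) + c * a (n + 1) ≤ (1 - μ * h) * (m n + c * a n) + c * D * h ^ 2 :=
    fun n => by
      have hac := mul_le_mul_of_nonneg_left (ha n) hc
      have habsorb := mul_le_mul_of_nonneg_right hcM (mul_nonneg hh (ha0 n))
      linarith [hm n]
  have hpow : ∀ n, m n + c * a n ≤ (1 - μ * h) ^ n * (m 0 + c * a 0) + c * D / μ * h := fun n => by
    induction n with
    | zero => simpa using (by positivity : 0 ≤ c * D / μ * h)
    | succ n ih =>
      calc m (n + 1) + c * a (n + 1)
          ≤ (1 - μ * h) * (m n + c * a n) + c * D * h ^ 2 := hstep n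
        _ ≤ (1 - μ * h) * ((1 - μ * h) ^ n * (m 0 + c * a 0) + c * D / μ * h) + c * D * h ^ 2 := by
            gcongr
        _ = (1 - μ * h) ^ (n + 1) * (m 0 + c * a 0) + c * D / μ * h := by
            field_simp
            ring
  have hexp : (1 - μ * h) ^ N ≤ Real.exp (-μ * N * h) := calc
    (1 - μ * h) ^ N ≤ Real.exp (-(μ * h)) ^ N :=
      pow_le_pow_left₀ (sub_nonneg.2 hμh) (Real.one_sub_le_exp_neg _) N
    _ = Real.exp (-μ * N * h) := by rw [← Real.exp_nat_mul]; ring_nf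
  have hinit : 0 ≤ m 0 + c * a 0 := add_nonneg h0 (mul_nonneg hc (ha0 0))
  exact (hpow N).trans (by gcongr)

end Recursion

section NoisyDescent

variable {Ω V : Type*} [MeasurableSpace Ω] [NormedAddCommGroup V] [InnerProductSpace ℝ V]

/-- `X` is an explicit Euler scheme for the flow of `-b` with step size `h`, perturbed by noises
`ξ n` that are centred, uncorrelated with the deterministic part of the step, and whose second
moment grows at most linearly with that of `X n - xs`. The independence of the noises only enters
through these conditions on their first two moments. -/
structure IsNoisyDescent (b : V → V) (xs : V) (h D : ℝ) (P : Measure Ω) (X ξ : ℕ → Ω → V) :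
    Prop where
  memLp_zero : MemLp (X 0) 2 P
  memLp_noise : ∀ n, MemLp (ξ n) 2 P
  step : ∀ n ω, X (n + 1) ω = X n ω - h • b (X n ω) + h • ξ n ω
  integral_noise : ∀ n, ∫ ω, ξ n ω ∂P = 0
  integral_inner_noise : ∀ n, ∫ ω, ⟪X n ω - h • b (X n ω) - xs, ξ n ω⟫ ∂P = 0
  integral_norm_noise_sq_le : ∀ n, ∫ ω, ‖ξ n ω‖ ^ 2 ∂P ≤ D * (1 + ∫ ω, ‖X n ω - xs‖ ^ 2 ∂P)

variable {b : V → V} {xs : V} {μ h D : ℝ} {L M : ℝ≥0} {P : Measure Ω} [IsProbabilityMeasure P]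
  {X ξ : ℕ → Ω → V}

lemma IsNoisyDescent.memLp (hX : IsNoisyDescent b xs h D P X ξ) (hL : LipschitzWith L b) (n : ℕ) :
    MemLp (X n) 2 P := by
  induction n with
  | zero => exact hX.memLp_zero
  | succ n ih =>
    rw [funext (hX.step n)]
    exact (memLp_sub_smul_comp hL ih h).add ((hX.memLp_noise n).const_smul h)

lemma IsNoisyDescent.norm_integral_sub_add_mul_integral_le [CompleteSpace V]
    (hX : IsNoisyDescent b xs h D P X ξ) (hL : LipschitzWith L b) (hb : StronglyMonotone μ b)
    (hd : Differentiable ℝ b) (hM : LipschitzWith M (fderiv ℝ b))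
    (hsymm : (fderiv ℝ b xs).IsSymmetric) (hxs : b xs = 0) (hμ : 0 < μ) (hh : 0 ≤ h) (hD : 0 ≤ D)
    (hhL : h * (L + μ) ≤ 1) (hhD : h * (2 * (L ^ 2 + D)) ≤ μ) (N : ℕ) :
    ‖(∫ ω, X N ω ∂P) - xs‖ + (2 * M / μ + 1) * ∫ ω, ‖X N ω - xs‖ ^ 2 ∂P
      ≤ Real.exp (-μ * N * h)
          * (‖(∫ ω, X 0 ω ∂P) - xs‖ + (2 * M / μ + 1) * ∫ ω, ‖X 0 ω - xs‖ ^ 2 ∂P)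
        + (2 * M / μ + 1) * D / μ * h := by
  have hhμ : h * μ ≤ 1 := by nlinarith [mul_nonneg hh L.coe_nonneg]
  have hnonneg : ∀ n, 0 ≤ ∫ ω, ‖X n ω - xs‖ ^ 2 ∂P := fun n =>
    integral_nonneg fun ω => sq_nonneg _
  refine add_mul_le_of_recursion (a := fun n => ∫ ω, ‖X n ω - xs‖ ^ 2 ∂P)
    (m := fun n => ‖(∫ ω, X n ω ∂P) - xs‖) (M := M) hμ hh (by linarith) hD (by positivity)
    ?_ hnonneg (fun n => ?_) (fun n => ?_) (norm_nonneg _) N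
  · rw [add_mul, div_mul_cancel₀ _ hμ.ne', one_mul]
    exact le_add_of_nonneg_right hμ.le
  · simp only [hX.step]
    refine (integral_norm_step_sub_sq_le hL hb hxs hh (hX.memLp hL n) (hX.memLp_noise n)
      (hX.integral_inner_noise n) (hX.integral_norm_noise_sq_le n)).trans ?_
    gcongr
    linarith [mul_le_mul_of_nonneg_left hhD hh]
  · simp only [hX.step]
    refine norm_integral_step_sub_le (A := fderiv ℝ b xs) hL (fun x => ?_) (fun v => ?_) hh
      (hX.memLp hL n) ((hX.memLp_noise n).integrable one_le_two) (hX.integral_noise n)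
    · simpa [hxs] using norm_sub_sub_fderiv_le hd hM xs x
    · exact norm_sub_smul_apply_le hsymm (hb.le_inner_fderiv (hd xs))
        (norm_fderiv_le_of_lipschitz ℝ hL) hh (by linarith) hhμ v

end NoisyDescent

section TestFunction

variable {Ω V : Type*} [MeasurableSpace Ω] {P : Measure Ω}
  [NormedAddCommGroup V] [InnerProductSpace ℝ V] [CompleteSpace V] {φ : V → ℝ} {T : ℝ≥0}
  {X : Ω → V}

lemma abs_sub_sub_inner_gradient_le (hφ : Differentiable ℝ φ) (hT : LipschitzWith T (fderiv ℝ φ))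
    (x y : V) : |φ y - φ x - ⟪∇ φ x, y - x⟫| ≤ T * ‖y - x‖ ^ 2 := by
  rw [inner_gradient_left]
  exact norm_sub_sub_fderiv_le hφ hT x y

lemma integrable_comp_of_lipschitzWith_fderiv [IsFiniteMeasure P] (hφ : Differentiable ℝ φ)
    (hT : LipschitzWith T (fderiv ℝ φ)) (hX : MemLp X 2 P) :
    Integrable (fun ω => φ (X ω)) P := by
  have hlin : Integrable (fun ω => φ 0 + ⟪∇ φ 0, X ω⟫) P :=
    (integrable_const _).add ((hX.integrable one_le_two).const_inner _)
  have hremainder : Integrable (fun ω => φ (X ω) - φ 0 - ⟪∇ φ 0, X ω⟫) P := by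
    have hcont : Continuous fun x => φ x - φ 0 - ⟪∇ φ 0, x⟫ := by
      have := hφ.continuous
      fun_prop
    refine ((integrable_norm_sub_sq hX 0).const_mul (T : ℝ)).mono'
      (hcont.comp_aestronglyMeasurable hX.aestronglyMeasurable) (.of_forall fun ω => ?_)
    simpa using abs_sub_sub_inner_gradient_le hφ hT 0 (X ω)
  exact (hlin.add hremainder).congr (.of_forall fun ω => by simp only [Pi.add_apply]; ring)

lemma abs_integral_comp_sub_le [IsProbabilityMeasure P] (hφ : Differentiable ℝ φ)
    (hT : LipschitzWith T (fderiv ℝ φ)) (hX : MemLp X 2 P) (xs : V) :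
    |(∫ ω, φ (X ω) ∂P) - φ xs|
      ≤ ‖∇ φ xs‖ * ‖(∫ ω, X ω ∂P) - xs‖ + T * ∫ ω, ‖X ω - xs‖ ^ 2 ∂P := by
  have hX1 : Integrable X P := hX.integrable one_le_two
  have hc1 : Integrable (fun ω => X ω - xs) P := hX1.sub (integrable_const xs)
  have hφX : Integrable (fun ω => φ (X ω)) P := integrable_comp_of_lipschitzWith_fderiv hφ hT hX
  have hφc : Integrable (fun ω => φ (X ω) - φ xs) P := hφX.sub (integrable_const _)
  have hsplit : (∫ ω, φ (X ω) ∂P) - φ xs = ⟪∇ φ xs, (∫ ω, X ω ∂P) - xs⟫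
      + ∫ ω, φ (X ω) - φ xs - ⟪∇ φ xs, X ω - xs⟫ ∂P := by
    rw [integral_sub hφc (hc1.const_inner _), integral_sub hφX (integrable_const _),
      integral_inner hc1, integral_sub hX1 (integrable_const xs)]
    simp only [integral_const, probReal_univ, one_smul]
    ring
  have hremainder : |∫ ω, φ (X ω) - φ xs - ⟪∇ φ xs, X ω - xs⟫ ∂P|
      ≤ T * ∫ ω, ‖X ω - xs‖ ^ 2 ∂P := by
    rw [← integral_const_mul, ← Real.norm_eq_abs]
    exact norm_integral_le_of_norm_le ((integrable_norm_sub_sq hX xs).const_mul (T : ℝ))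
      (.of_forall fun ω => abs_sub_sub_inner_gradient_le hφ hT xs (X ω))
  rw [hsplit]
  exact (abs_add_le _ _).trans (add_le_add (abs_real_inner_le_norm _ _) hremainder)

end TestFunction

section WeakError

variable {Ω V : Type*} [MeasurableSpace Ω] {P : Measure Ω} [IsProbabilityMeasure P]
  [NormedAddCommGroup V] [InnerProductSpace ℝ V] [CompleteSpace V] {b : V → V} {xs : V}
  {μ h D : ℝ} {L M T : ℝ≥0} {X ξ : ℕ → Ω → V} {φ : V → ℝ}

lemma IsNoisyDescent.abs_integral_comp_sub_le (hX : IsNoisyDescent b xs h D P X ξ)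
    (hL : LipschitzWith L b) (hb : StronglyMonotone μ b) (hd : Differentiable ℝ b)
    (hM : LipschitzWith M (fderiv ℝ b)) (hsymm : (fderiv ℝ b xs).IsSymmetric) (hxs : b xs = 0)
    (hμ : 0 < μ) (hh : 0 ≤ h) (hD : 0 ≤ D) (hhL : h * (L + μ) ≤ 1)
    (hhD : h * (2 * (L ^ 2 + D)) ≤ μ) (hφ : Differentiable ℝ φ)
    (hT : LipschitzWith T (fderiv ℝ φ)) (N : ℕ) :
    |(∫ ω, φ (X N ω) ∂P) - φ xs|
      ≤ (2 * M / μ + 1) * (1 + D / μ) * (‖∇ φ xs‖ + T)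
        * ((‖(∫ ω, X 0 ω ∂P) - xs‖ + ∫ ω, ‖X 0 ω - xs‖ ^ 2 ∂P) * Real.exp (-μ * N * h) + h) := by
  have hbound := hX.norm_integral_sub_add_mul_integral_le hL hb hd hM hsymm hxs hμ hh hD hhL hhD N
  set c : ℝ := 2 * M / μ + 1
  have hc : 1 ≤ c := le_add_of_nonneg_left (by positivity)
  set m : ℕ → ℝ := fun n => ‖(∫ ω, X n ω ∂P) - xs‖
  set a : ℕ → ℝ := fun n => ∫ ω, ‖X n ω - xs‖ ^ 2 ∂P
  have hm : ∀ n, 0 ≤ m n := fun n => norm_nonneg _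
  have ha : ∀ n, 0 ≤ a n := fun n => integral_nonneg fun ω => sq_nonneg _
  have hδ : 0 ≤ D / μ := by positivity
  have hmoments : m N + c * a N
      ≤ c * (1 + D / μ) * ((m 0 + a 0) * Real.exp (-μ * N * h) + h) := calc
    m N + c * a N ≤ Real.exp (-μ * N * h) * (m 0 + c * a 0) + c * D / μ * h := hbound
    _ ≤ Real.exp (-μ * N * h) * (c * (1 + D / μ) * (m 0 + a 0)) + c * (1 + D / μ) * h := by
        gcongr
        · nlinarith [mul_nonneg (sub_nonneg.2 hc) (hm 0),
            mul_nonneg (mul_nonneg (zero_le_one.trans hc) hδ) (add_nonneg (hm 0) (ha 0))]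
        · rw [mul_div_assoc]
          gcongr
          exact le_add_of_nonneg_left zero_le_one
    _ = _ := by ring
  calc |(∫ ω, φ (X N ω) ∂P) - φ xs| ≤ ‖∇ φ xs‖ * m N + T * a N :=
        SGD.abs_integral_comp_sub_le hφ hT (hX.memLp hL N) xs
    _ ≤ (‖∇ φ xs‖ + T) * (m N + c * a N) := by
        have hcross := mul_nonneg (norm_nonneg (∇ φ xs)) (mul_nonneg (zero_le_one.trans hc) (ha N))
        have hTm := mul_nonneg T.coe_nonneg (hm N)
        have hTa := mul_nonneg T.coe_nonneg (mul_nonneg (sub_nonneg.2 hc) (ha N))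
        linarith
    _ ≤ (‖∇ φ xs‖ + T) * (c * (1 + D / μ) * ((m 0 + a 0) * Real.exp (-μ * N * h) + h)) := by
        gcongr
    _ = _ := by ring

end WeakError

section IndependentNoise

variable {Ω V W : Type*} [MeasurableSpace Ω] {P : Measure Ω}

section Apply

variable [NormedAddCommGroup V] [NormedSpace ℝ V] [NormedAddCommGroup W] [NormedSpace ℝ W]

lemma norm_apply_sq_le (A : W →L[ℝ] V) (w : W) : ‖A w‖ ^ 2 ≤ ‖A‖ ^ 2 * ‖w‖ ^ 2 := by
  rw [← mul_pow]
  gcongr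
  exact A.le_opNorm w

variable [MeasurableSpace W] [BorelSpace W] {A : Ω → W →L[ℝ] V} {g : Ω → W}

lemma integrable_norm_sq_mul_of_indepFun (hA : MemLp A 2 P) (hg : MemLp g 2 P)
    (hind : IndepFun A g P) : Integrable (fun ω => ‖A ω‖ ^ 2 * ‖g ω‖ ^ 2) P :=
  (hind.comp (measurable_norm.pow_const 2) (measurable_norm.pow_const 2)).integrable_mul
    (hA.integrable_norm_pow two_ne_zero) (hg.integrable_norm_pow two_ne_zero)

lemma memLp_two_apply_of_indepFun (hA : MemLp A 2 P) (hg : MemLp g 2 P) (hind : IndepFun A g P) :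
    MemLp (fun ω => A ω (g ω)) 2 P := by
  have hmeas : AEStronglyMeasurable (fun ω => A ω (g ω)) P :=
    (ContinuousLinearMap.id ℝ (W →L[ℝ] V)).aestronglyMeasurable_comp₂ hA.1 hg.1
  refine (memLp_two_iff_integrable_sq_norm hmeas).2
    ((integrable_norm_sq_mul_of_indepFun hA hg hind).mono' (hmeas.norm.pow 2)
      (.of_forall fun ω => ?_))
  simpa using norm_apply_sq_le (A ω) (g ω)

lemma integral_norm_apply_sq_le_of_indepFun (hA : MemLp A 2 P) (hg : MemLp g 2 P)
    (hind : IndepFun A g P) :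
    ∫ ω, ‖A ω (g ω)‖ ^ 2 ∂P ≤ (∫ ω, ‖A ω‖ ^ 2 ∂P) * ∫ ω, ‖g ω‖ ^ 2 ∂P := by
  have hprod := (hind.comp (measurable_norm.pow_const 2)
    (measurable_norm.pow_const 2)).integral_fun_mul_eq_mul_integral
      (hA.integrable_norm_pow two_ne_zero).aestronglyMeasurable
      (hg.integrable_norm_pow two_ne_zero).aestronglyMeasurable
  exact (integral_mono
    ((memLp_two_apply_of_indepFun hA hg hind).integrable_norm_pow two_ne_zero)
    (integrable_norm_sq_mul_of_indepFun hA hg hind)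
    fun ω => norm_apply_sq_le (A ω) (g ω)).trans_eq hprod

lemma integral_apply_eq_zero_of_indepFun [CompleteSpace V] [CompleteSpace W]
    (hA : Integrable A P) (hg : Integrable g P) (hind : IndepFun A g P)
    (hg0 : ∫ ω, g ω ∂P = 0) : ∫ ω, A ω (g ω) ∂P = 0 := by
  simpa [hg0] using hind.integral_bilin hA hg (ContinuousLinearMap.id ℝ (W →L[ℝ] V))

lemma integral_inner_apply_eq_zero_of_indepFun {V : Type*} [NormedAddCommGroup V]
    [InnerProductSpace ℝ V] [CompleteSpace W] {A : Ω → W →L[ℝ] V} {Y : Ω → V} (hY : MemLp Y 2 P)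
    (hA : MemLp A 2 P) (hg : Integrable g P)
    (hind : IndepFun (fun ω => (innerSL ℝ (Y ω)).comp (A ω)) g P) (hg0 : ∫ ω, g ω ∂P = 0) :
    ∫ ω, ⟪Y ω, A ω (g ω)⟫ ∂P = 0 := by
  have hmeas : AEStronglyMeasurable (fun ω => (innerSL ℝ (Y ω)).comp (A ω)) P :=
    (ContinuousLinearMap.compL ℝ W V ℝ).aestronglyMeasurable_comp₂
      ((innerSL ℝ).continuous.comp_aestronglyMeasurable hY.1) hA.1
  refine integral_apply_eq_zero_of_indepFun (A := fun ω => (innerSL ℝ (Y ω)).comp (A ω))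
    ((hY.norm.integrable_mul hA.norm).mono' hmeas (.of_forall fun ω => ?_)) hg hind hg0
  exact (ContinuousLinearMap.opNorm_comp_le _ _).trans_eq (by rw [innerSL_apply_norm]; rfl)

end Apply

section LinearGrowth

variable [IsProbabilityMeasure P] [NormedAddCommGroup V] [NormedAddCommGroup W] {f : V → W}
  {X : Ω → V} {xs : V} {κ : ℝ}

lemma memLp_comp_of_norm_sq_le (hf : Continuous f)
    (hκ : ∀ x, ‖f x‖ ^ 2 ≤ κ * (1 + ‖x - xs‖ ^ 2)) (hX : MemLp X 2 P) :
    MemLp (fun ω => f (X ω)) 2 P := by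
  have hmeas := hf.comp_aestronglyMeasurable hX.aestronglyMeasurable
  refine (memLp_two_iff_integrable_sq_norm hmeas).2
    ((((integrable_const 1).add (integrable_norm_sub_sq hX xs)).const_mul κ).mono'
      (hmeas.norm.pow 2) (.of_forall fun ω => ?_))
  simpa using hκ (X ω)

lemma integral_norm_comp_sq_le (hf : Continuous f)
    (hκ : ∀ x, ‖f x‖ ^ 2 ≤ κ * (1 + ‖x - xs‖ ^ 2)) (hX : MemLp X 2 P) :
    ∫ ω, ‖f (X ω)‖ ^ 2 ∂P ≤ κ * (1 + ∫ ω, ‖X ω - xs‖ ^ 2 ∂P) := by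
  have hX2 := integrable_norm_sub_sq hX xs
  have hone : Integrable (fun _ => (1 : ℝ)) P := integrable_const 1
  calc ∫ ω, ‖f (X ω)‖ ^ 2 ∂P ≤ ∫ ω, κ * (1 + ‖X ω - xs‖ ^ 2) ∂P :=
        integral_mono ((memLp_comp_of_norm_sq_le hf hκ hX).integrable_norm_pow two_ne_zero)
          ((hone.add hX2).const_mul κ) fun ω => hκ (X ω)
    _ = κ * (1 + ∫ ω, ‖X ω - xs‖ ^ 2 ∂P) := by
        rw [integral_const_mul, integral_add hone hX2]
        simp

end LinearGrowth

lemma isNoisyDescent_of_indepFun [IsProbabilityMeasure P]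
    [NormedAddCommGroup V] [InnerProductSpace ℝ V] [CompleteSpace V]
    [MeasurableSpace V] [BorelSpace V] [NormedAddCommGroup W] [NormedSpace ℝ W] [CompleteSpace W]
    [MeasurableSpace W] [BorelSpace W] {b : V → V} {σ : ℕ → V → W →L[ℝ] V} {xs : V} {L : ℝ≥0}
    {κ G h : ℝ} {X : ℕ → Ω → V} {g : ℕ → Ω → W} (hL : LipschitzWith L b)
    (hσ : ∀ n, Continuous (σ n)) (hκ : ∀ n x, ‖σ n x‖ ^ 2 ≤ κ * (1 + ‖x - xs‖ ^ 2))
    (hg : ∀ n, MemLp (g n) 2 P) (hg0 : ∀ n, ∫ ω, g n ω ∂P = 0)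
    (hG : ∀ n, ∫ ω, ‖g n ω‖ ^ 2 ∂P ≤ G) (hind : ∀ n, IndepFun (X n) (g n) P)
    (hX0 : MemLp (X 0) 2 P)
    (hstep : ∀ n ω, X (n + 1) ω = X n ω - h • b (X n ω) + h • σ n (X n ω) (g n ω)) :
    IsNoisyDescent b xs h (κ * G) P X fun n ω => σ n (X n ω) (g n ω) := by
  have hσg : ∀ n, IndepFun (fun ω => σ n (X n ω)) (g n) P := fun n =>
    (hind n).comp (hσ n).measurable measurable_id
  have hnoise : ∀ n, MemLp (X n) 2 P → MemLp (fun ω => σ n (X n ω) (g n ω)) 2 P := fun n hX =>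
    memLp_two_apply_of_indepFun (memLp_comp_of_norm_sq_le (hσ n) (hκ n) hX) (hg n) (hσg n)
  have hX : ∀ n, MemLp (X n) 2 P := fun n => by
    induction n with
    | zero => exact hX0
    | succ n ih =>
      rw [funext (hstep n)]
      exact (memLp_sub_smul_comp hL ih h).add ((hnoise n ih).const_smul h)
  have hσX : ∀ n, MemLp (fun ω => σ n (X n ω)) 2 P := fun n =>
    memLp_comp_of_norm_sq_le (hσ n) (hκ n) (hX n)
  refine ⟨hX0, fun n => hnoise n (hX n), hstep, fun n => ?_, fun n => ?_, fun n => ?_⟩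
  · exact integral_apply_eq_zero_of_indepFun ((hσX n).integrable one_le_two)
      ((hg n).integrable one_le_two) (hσg n) (hg0 n)
  · have hfunctional : Continuous fun x => (innerSL ℝ (x - h • b x - xs)).comp (σ n x) := by
      have := hL.continuous
      have := hσ n
      fun_prop
    exact integral_inner_apply_eq_zero_of_indepFun
      ((memLp_sub_smul_comp hL (hX n) h).sub (memLp_const xs)) (hσX n)
      ((hg n).integrable one_le_two) ((hind n).comp hfunctional.measurable measurable_id) (hg0 n)
  · have hσ2 := integral_norm_comp_sq_le (hσ n) (hκ n) (hX n)
    calc ∫ ω, ‖σ n (X n ω) (g n ω)‖ ^ 2 ∂P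
        ≤ (∫ ω, ‖σ n (X n ω)‖ ^ 2 ∂P) * ∫ ω, ‖g n ω‖ ^ 2 ∂P :=
          integral_norm_apply_sq_le_of_indepFun (hσX n) (hg n) (hσg n)
      _ ≤ κ * (1 + ∫ ω, ‖X n ω - xs‖ ^ 2 ∂P) * G :=
          mul_le_mul hσ2 (hG n) (integral_nonneg fun _ => sq_nonneg _)
            ((integral_nonneg fun _ => sq_nonneg _).trans hσ2)
      _ = κ * G * (1 + ∫ ω, ‖X n ω - xs‖ ^ 2 ∂P) := by ring

end IndependentNoise

section Recursion

variable {Ω V W : Type*} [MeasurableSpace V] [MeasurableSpace W] {f : ℕ → V × W → V}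
  {X : ℕ → Ω → V} {g : ℕ → Ω → W} {x₀ : V}

lemma exists_measurable_eq_of_recursion (hf : ∀ n, Measurable (f n)) (h0 : ∀ ω, X 0 ω = x₀)
    (hstep : ∀ n ω, X (n + 1) ω = f n (X n ω, g n ω)) (n : ℕ) :
    ∃ Φ : (Finset.range n → W) → V, Measurable Φ ∧ ∀ ω, X n ω = Φ fun i => g i ω := by
  induction n with
  | zero => exact ⟨fun _ => x₀, measurable_const, h0⟩
  | succ n ih =>
    obtain ⟨Φ, hΦ, hXΦ⟩ := ih
    refine ⟨fun u => f n (Φ fun i => u ⟨i, Finset.range_mono n.le_succ i.2⟩,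
      u ⟨n, Finset.self_mem_range_succ n⟩), by fun_prop, fun ω => ?_⟩
    rw [hstep, hXΦ]

lemma indepFun_of_recursion [MeasurableSpace Ω] {P : Measure Ω} (hf : ∀ n, Measurable (f n))
    (h0 : ∀ ω, X 0 ω = x₀) (hstep : ∀ n ω, X (n + 1) ω = f n (X n ω, g n ω))
    (hg : ∀ n, AEMeasurable (g n) P) (hind : iIndepFun g P) (n : ℕ) : IndepFun (X n) (g n) P := by
  obtain ⟨Φ, hΦ, hXΦ⟩ := exists_measurable_eq_of_recursion hf h0 hstep n
  rw [funext hXΦ]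
  exact (hind.indepFun_finset₀ (Finset.range n) {n} (by simp) hg).comp hΦ
    (measurable_pi_apply (⟨n, Finset.mem_singleton_self n⟩ : ({n} : Finset ℕ)))

end Recursion

lemma isNoisyDescent_of_iIndepFun {Ω V W : Type*} [MeasurableSpace Ω] {P : Measure Ω}
    [IsProbabilityMeasure P] [NormedAddCommGroup V] [InnerProductSpace ℝ V] [CompleteSpace V]
    [MeasurableSpace V] [BorelSpace V] [NormedAddCommGroup W] [NormedSpace ℝ W] [CompleteSpace W]
    [MeasurableSpace W] [BorelSpace W] [SecondCountableTopologyEither V W] {b : V → V}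
    {σ : ℕ → V → W →L[ℝ] V} {x₀ xs : V} {L : ℝ≥0} {κ G h : ℝ} {X : ℕ → Ω → V} {g : ℕ → Ω → W}
    (hL : LipschitzWith L b) (hσ : ∀ n, Continuous (σ n))
    (hκ : ∀ n x, ‖σ n x‖ ^ 2 ≤ κ * (1 + ‖x - xs‖ ^ 2)) (hg : ∀ n, MemLp (g n) 2 P)
    (hg0 : ∀ n, ∫ ω, g n ω ∂P = 0) (hG : ∀ n, ∫ ω, ‖g n ω‖ ^ 2 ∂P ≤ G) (hind : iIndepFun g P)
    (h0 : ∀ ω, X 0 ω = x₀)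
    (hstep : ∀ n ω, X (n + 1) ω = X n ω - h • b (X n ω) + h • σ n (X n ω) (g n ω)) :
    IsNoisyDescent b xs h (κ * G) P X fun n ω => σ n (X n ω) (g n ω) := by
  have hcont : ∀ n, Continuous fun p : V × W => p.1 - h • b p.1 + h • σ n p.1 p.2 := fun n => by
    have := hL.continuous
    have := hσ n
    fun_prop
  refine isNoisyDescent_of_indepFun hL hσ hκ hg hg0 hG
    (indepFun_of_recursion (fun n => (hcont n).measurable) h0 hstep
      (fun n => (hg n).aemeasurable) hind) ?_ hstep
  rw [funext h0]
  exact memLp_const x₀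

lemma memLp_two_of_hasLaw_isGaussian {Ω V : Type*} [MeasurableSpace Ω] {P : Measure Ω}
    [NormedAddCommGroup V] [NormedSpace ℝ V] [CompleteSpace V] [SecondCountableTopology V]
    [MeasurableSpace V] [BorelSpace V] {ν : Measure V} [IsGaussian ν] {g : Ω → V}
    (hg : HasLaw g ν P) : MemLp g 2 P := by
  have hid : MemLp id 2 (P.map g) := by
    rw [hg.map_eq]
    exact IsGaussian.memLp_two_id
  exact hid.comp_of_map hg.aemeasurable

section Constants

lemma add_sq_mul_add_le {ρ e h : ℝ} (hρ : 0 ≤ ρ) (he : 0 ≤ e) (hh : 0 ≤ h) :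
    (ρ + ρ ^ 2) * e + h ≤ 2 * (1 + ρ ^ 3) * (e + h) := by
  have hcubic : ρ + ρ ^ 2 ≤ 2 * (1 + ρ ^ 3) := by
    nlinarith [mul_nonneg hρ (sq_nonneg (ρ - 1)), sq_nonneg (ρ - 1)]
  have hone : 1 ≤ 2 * (1 + ρ ^ 3) := by linarith [pow_nonneg hρ 3]
  calc (ρ + ρ ^ 2) * e + h ≤ 2 * (1 + ρ ^ 3) * e + 2 * (1 + ρ ^ 3) * h :=
        add_le_add (mul_le_mul_of_nonneg_right hcubic he) (le_mul_of_one_le_left hh hone)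
    _ = 2 * (1 + ρ ^ 3) * (e + h) := by ring

lemma exists_stepSize_bound {L μ D hmax : ℝ} (hL : 0 ≤ L) (hμ : 0 < μ) (hD : 0 ≤ D)
    (hhmax : 0 < hmax) : ∃ H, 0 < H ∧ H < hmax ∧
      ∀ h, 0 ≤ h → h < H → h * (L + μ) ≤ 1 ∧ h * (2 * (L ^ 2 + D)) ≤ μ := by
  refine ⟨min (hmax / 2) (min (1 / (L + μ)) (μ / (2 * (L ^ 2 + D) + 1))), by positivity,
    (min_le_left _ _).trans_lt (half_lt_self hhmax), fun h hh hlt => ?_⟩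
  obtain ⟨-, hL', hD'⟩ := lt_min_iff.1 hlt |>.imp id lt_min_iff.1
  rw [lt_div_iff₀ (by positivity)] at hL' hD'
  exact ⟨hL'.le, by linarith⟩

end Constants

section EuclideanScheme

variable {d : ℕ}

lemma norm_matVec_le (M : Matrix (Fin d) (Fin d) ℝ) (v : E d) :
    ‖matVec M v‖ ≤ matNorm M * ‖v‖ := by
  rw [EuclideanSpace.norm_eq, EuclideanSpace.norm_eq, matNorm, ← Real.sqrt_mul (by positivity)]
  refine Real.sqrt_le_sqrt ?_
  rw [Finset.sum_mul]
  refine Finset.sum_le_sum fun i _ => ?_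
  simp only [matVec, Matrix.mulVec, dotProduct, Real.norm_eq_abs, sq_abs]
  exact Finset.sum_mul_sq_le_sq_mul_sq _ _ _

lemma norm_toEuclideanCLM_le (M : Matrix (Fin d) (Fin d) ℝ) :
    ‖Matrix.toEuclideanCLM (𝕜 := ℝ) M‖ ≤ matNorm M :=
  ContinuousLinearMap.opNorm_le_bound _ (Real.sqrt_nonneg _) (norm_matVec_le M)

lemma continuous_toEuclideanCLM :
    Continuous (Matrix.toEuclideanCLM (n := Fin d) (𝕜 := ℝ)) :=
  LinearMap.continuous_of_finiteDimensional
    (Matrix.toEuclideanCLM (n := Fin d) (𝕜 := ℝ)).toAlgEquiv.toLinearMap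

namespace DiffusionAssumption

variable {σ : ℝ → E d → Matrix (Fin d) (Fin d) ℝ} {xs : E d}

lemma continuous (hσ : DiffusionAssumption σ xs) {t : ℝ} (ht : 0 ≤ t) : Continuous (σ t) :=
  hσ.continuousOn.comp_continuous (f := fun x : E d => (t, x)) (by fun_prop)
    fun _ => ⟨ht, mem_univ _⟩

lemma exists_matNorm_sq_le (hσ : DiffusionAssumption σ xs) :
    ∃ κ, 0 ≤ κ ∧ ∀ t, 0 ≤ t → ∀ x, matNorm (σ t x) ^ 2 ≤ κ * (1 + ‖x - xs‖ ^ 2) := by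
  obtain ⟨ς, -, -, hgrowth, K, hK⟩ := hσ.exists_bound
  refine ⟨2 * K ^ 2, by positivity, fun t ht x => ?_⟩
  have hle : matNorm (σ t x) ≤ K * (1 + ‖x - xs‖) :=
    (div_le_iff₀ (by positivity)).1 ((hgrowth t ht x).trans (hK t ht))
  calc matNorm (σ t x) ^ 2 ≤ (K * (1 + ‖x - xs‖)) ^ 2 :=
        pow_le_pow_left₀ (Real.sqrt_nonneg _) hle 2
    _ = K ^ 2 * (1 + ‖x - xs‖) ^ 2 := mul_pow _ _ _
    _ ≤ K ^ 2 * (2 * (1 ^ 2 + ‖x - xs‖ ^ 2)) := by gcongr; exact add_sq_le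
    _ = 2 * K ^ 2 * (1 + ‖x - xs‖ ^ 2) := by ring

lemma exists_isNoisyDescent_scheme {F : E d → ℝ} {L : ℝ≥0} (hσ : DiffusionAssumption σ xs)
    (hL : LipschitzWith L (∇ F)) :
    ∃ D, 0 ≤ D ∧ ∀ (Ω : Type*) [MeasurableSpace Ω] (P : Measure Ω) [IsProbabilityMeasure P]
      (γ : ℕ → Ω → E d), (∀ n, HasLaw (γ (n + 1)) (stdGaussian (E d)) P) →
      iIndepFun (fun n => γ (n + 1)) P → ∀ (x₀ : E d) (h : ℝ), 0 ≤ h →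
      IsNoisyDescent (∇ F) xs h D P (scheme F σ γ h x₀)
        fun n ω => matVec (σ (n * h) (scheme F σ γ h x₀ n ω)) (γ (n + 1) ω) := by
  obtain ⟨κ, hκ0, hκ⟩ := hσ.exists_matNorm_sq_le
  refine ⟨κ * ∫ x, ‖x‖ ^ 2 ∂stdGaussian (E d),
    mul_nonneg hκ0 (integral_nonneg fun _ => sq_nonneg _), ?_⟩
  intro Ω _ P _ γ hγ hind x₀ h hh
  have ht : ∀ n : ℕ, 0 ≤ n * h := fun n => by positivity
  exact isNoisyDescent_of_iIndepFun (g := fun n => γ (n + 1)) (x₀ := x₀)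
    (σ := fun n x => Matrix.toEuclideanCLM (𝕜 := ℝ) (σ (n * h) x)) hL
    (fun n => continuous_toEuclideanCLM.comp (hσ.continuous (ht n)))
    (fun n x => (pow_le_pow_left₀ (norm_nonneg _) (norm_toEuclideanCLM_le _) 2).trans
      (hκ _ (ht n) x))
    (fun n => memLp_two_of_hasLaw_isGaussian (hγ n))
    (fun n => by rw [(hγ n).integral_eq, integral_id_stdGaussian])
    (fun n => ((hγ n).integral_comp (f := fun x => ‖x‖ ^ 2) (by fun_prop)).le) hind
    (fun _ => rfl) fun _ _ => rfl

end DiffusionAssumption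

namespace ObjectiveAssumption

variable {F : E d → ℝ} {μ : ℝ}

lemma stronglyMonotone_gradient (hF : ObjectiveAssumption F μ) : StronglyMonotone μ (∇ F) :=
  hF.mu_convex

lemma exists_lipschitzWith_gradient (hF : ObjectiveAssumption F μ) :
    ∃ L, LipschitzWith L (∇ F) := by
  obtain ⟨L, hL0, hL⟩ := hF.lipschitz
  refine ⟨⟨L, hL0.le⟩, .of_dist_le_mul fun x y => ?_⟩
  rw [dist_eq_norm, dist_eq_norm]
  exact hL y x

lemma exists_lipschitzWith_fderiv_gradient (hF : ObjectiveAssumption F μ) :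
    ∃ M, LipschitzWith M (fderiv ℝ (∇ F)) := by
  obtain ⟨M, hM⟩ := hF.bounded_third
  refine ⟨⟨M, (norm_nonneg _).trans (hM 0)⟩, lipschitzWith_fderiv_of_norm_iteratedFDeriv_two_le
    (contDiff_gradient hF.contDiff (by norm_num)) fun x => ?_⟩
  rw [norm_iteratedFDeriv_gradient]
  exact hM x

end ObjectiveAssumption

lemma tripleNorm_nonneg (m : ℕ) (φ : E d → ℝ) : 0 ≤ tripleNorm m φ :=
  Real.iSup_nonneg fun _ => norm_nonneg _

lemma norm_iteratedFDeriv_le_tripleNorm {m : ℕ} {φ : E d → ℝ}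
    (hφ : ∃ M, ∀ x, ‖iteratedFDeriv ℝ m φ x‖ ≤ M) (x : E d) :
    ‖iteratedFDeriv ℝ m φ x‖ ≤ tripleNorm m φ := by
  obtain ⟨M, hM⟩ := hφ
  exact le_ciSup (f := fun y => ‖iteratedFDeriv ℝ m φ y‖) ⟨M, forall_mem_range.2 hM⟩ x

lemma lipschitzWith_fderiv_tripleNorm {φ : E d → ℝ} (hφ : ContDiff ℝ 2 φ)
    (hbdd : ∃ M, ∀ x, ‖iteratedFDeriv ℝ 2 φ x‖ ≤ M) :
    LipschitzWith (tripleNorm 2 φ).toNNReal (fderiv ℝ φ) :=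
  lipschitzWith_fderiv_of_norm_iteratedFDeriv_two_le hφ fun x =>
    (norm_iteratedFDeriv_le_tripleNorm hbdd x).trans (Real.le_coe_toNNReal _)

end EuclideanScheme

end SGD

theorem theorem1_general {V : Type*} [NormedAddCommGroup V] [InnerProductSpace ℝ V]
    [CompleteSpace V] {F : V → ℝ} {μ : ℝ} {L M : ℝ≥0} (hF : ContDiff ℝ 2 F) (hμ : 0 < μ)
    (hmono : SGD.StronglyMonotone μ (∇ F)) (hL : LipschitzWith L (∇ F))
    (hM : LipschitzWith M (fderiv ℝ (∇ F))) :
    (∃! xs, ∀ y, F xs ≤ F y) ∧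
    ∀ xs, (∀ y, F xs ≤ F y) → ∀ D, 0 ≤ D → ∀ hmax, 0 < hmax →
    ∃ H C : ℝ, 0 < H ∧ H < hmax ∧ 0 < C ∧
      ∀ (Ω : Type*) [MeasurableSpace Ω] (P : Measure Ω) [IsProbabilityMeasure P]
        (h : ℝ) (X ξ : ℕ → Ω → V), 0 < h → h < H → SGD.IsNoisyDescent (∇ F) xs h D P X ξ →
      ∀ (φ : V → ℝ) (T : ℝ≥0), Differentiable ℝ φ → LipschitzWith T (fderiv ℝ φ) → ∀ N : ℕ,
        Integrable (fun ω => φ (X N ω)) P ∧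
        |(∫ ω, φ (X N ω) ∂P) - φ xs|
          ≤ C * (‖∇ φ xs‖ + T) * ((‖(∫ ω, X 0 ω ∂P) - xs‖ + ∫ ω, ‖X 0 ω - xs‖ ^ 2 ∂P)
            * Real.exp (-μ * N * h) + h) := by
  have hdiff : Differentiable ℝ (∇ F) :=
    (SGD.contDiff_gradient (m := 1) hF (by norm_num)).differentiable (by norm_num)
  refine ⟨hmono.existsUnique_forall_le (hF.differentiable (by norm_num)) hμ hL, ?_⟩
  intro xs hxs D hD hmax hhmax
  obtain ⟨H, hH0, hHmax, hH⟩ := SGD.exists_stepSize_bound L.coe_nonneg hμ hD hhmax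
  refine ⟨H, (2 * M / μ + 1) * (1 + D / μ), hH0, hHmax, by positivity, ?_⟩
  intro Ω _ P _ h X ξ hh hhH hX φ T hφ hT N
  exact ⟨SGD.integrable_comp_of_lipschitzWith_fderiv hφ hT (hX.memLp hL N),
    hX.abs_integral_comp_sub_le hL hmono hdiff hM (SGD.isSymmetric_fderiv_gradient hF xs)
      (SGD.gradient_eq_zero_of_forall_le hxs) hμ hh.le hD (hH h hh.le hhH).1 (hH h hh.le hhH).2
      hφ hT N⟩

theorem theorem1 {d : ℕ} (F : SGD.E d → ℝ) (μ : ℝ) (hF : SGD.ObjectiveAssumption F μ) :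
    (∃! xs : SGD.E d, ∀ y, F xs ≤ F y) ∧
    ∀ xs : SGD.E d, (∀ y, F xs ≤ F y) →
    ∀ σ : ℝ → SGD.E d → Matrix (Fin d) (Fin d) ℝ, SGD.DiffusionAssumption σ xs →
    ∀ hmax : ℝ, 0 < hmax →
    ∃ H C : ℝ, 0 < H ∧ H < hmax ∧ 0 < C ∧
      ∀ (Ω : Type*) [MeasurableSpace Ω] (P : Measure Ω) [IsProbabilityMeasure P]
        (γ : ℕ → Ω → SGD.E d),
        (∀ n : ℕ, HasLaw (γ (n + 1)) (stdGaussian (SGD.E d)) P) →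
        iIndepFun (fun n : ℕ => γ (n + 1)) P →
      ∀ φ : SGD.E d → ℝ, ContDiff ℝ 2 φ →
        (∃ M : ℝ, ∀ x, ‖iteratedFDeriv ℝ 2 φ x‖ ≤ M) →
      ∀ (x₀ : SGD.E d) (N : ℕ), 1 ≤ N → ∀ h : ℝ, 0 < h → h < H →
        Integrable (fun ω => φ (SGD.scheme F σ γ h x₀ N ω)) P ∧
        |(∫ ω, φ (SGD.scheme F σ γ h x₀ N ω) ∂P) - φ xs|
          ≤ C * (‖∇ φ xs‖ + SGD.tripleNorm 2 φ) * (1 + ‖x₀ - xs‖ ^ 3)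
            * (Real.exp (-μ * N * h) + h) := by
  obtain ⟨L, hL⟩ := hF.exists_lipschitzWith_gradient
  obtain ⟨M, hM⟩ := hF.exists_lipschitzWith_fderiv_gradient
  obtain ⟨hmin, hrate⟩ := theorem1_general (hF.contDiff.of_le (by norm_num)) hF.mu_pos
    hF.stronglyMonotone_gradient hL hM
  refine ⟨hmin, fun xs hxs σ hσ hmax hhmax => ?_⟩
  obtain ⟨D, hD0, hD⟩ := hσ.exists_isNoisyDescent_scheme hL
  obtain ⟨H, C, hH0, hHmax, hC0, hHC⟩ := hrate xs hxs D hD0 hmax hhmax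
  refine ⟨H, 2 * C, hH0, hHmax, by positivity, ?_⟩
  intro Ω _ P _ γ hγ hind φ hφ hbdd x₀ N _ h hh hhH
  obtain ⟨hint, hbound⟩ := hHC Ω P h _ _ hh hhH (hD Ω P γ hγ hind x₀ h hh.le) φ _
    (hφ.differentiable (by norm_num)) (SGD.lipschitzWith_fderiv_tripleNorm hφ hbdd) N
  have hx₀ := SGD.add_sq_mul_add_le (norm_nonneg (x₀ - xs)) (Real.exp_nonneg (-μ * N * h)) hh.le
  have hscale : 0 ≤ C * (‖∇ φ xs‖ + SGD.tripleNorm 2 φ) := by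
    have := SGD.tripleNorm_nonneg 2 φ
    positivity
  simp only [SGD.scheme, integral_const, probReal_univ, one_smul,
    Real.coe_toNNReal _ (SGD.tripleNorm_nonneg 2 φ)] at hbound
  exact ⟨hint, (hbound.trans (mul_le_mul_of_nonneg_left hx₀ hscale)).trans_eq (by ring)⟩
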